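/- Let $d\ge 1$ and let $\nu$ be a finite Borel measure on $\mathbb{R}^d$ with $\int e^{\delta\|\lambda\|}\,\nu(d\lambda)<\infty$ for some $\delta>0$, where $\|\cdot\|$ is the Euclidean norm. Then there is a constant $K>0$, depending only on $\nu$ and $d$, with the following property. Let $W=(W_t)_{t\in\mathbb{R}^d}$ be any centered homogeneous real Gaussian random field with spectral measure $\nu$, that is, $\mathrm{E}(W_sW_t)=\int e^{-i(\lambda,\,s-t)}\,\nu(d\lambda)$ for all $s,t\in\mathbb{R}^d$. For a vector $a=(a_1,\dots,a_d)$ with $a_j\ge 0$, let $W^a=\{W_{(a_1t_1,\dots,a_dt_d)} : t\in[0,1]^d\}$ be the rescaled process, and let $\mathbb{H}_1^a$ be the closed unit ball of its reproducing kernel Hilbert space, i.e. of the completion of the space of functions $t\mapsto \mathrm{E}(W^a_tH)$ on $[0,1]^d$, $H$ a finite linear combination of the variables $W^a_s$, $s\in[0,1]^d$, under the inner product $\langle \mathrm{E}(W^aH_1),\mathrm{E}(W^aH_2)\rangle=\mathrm{E}(H_1H_2)$. Let $\mathcal{S}^{(0)}_{d-1}=\{\theta\in\mathbb{R}^d:\theta_j>0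 \text{ for all } j,\ \sum_j\theta_j=1\}$ and, for $r\ge 1$, let $\mathcal{Q}^{(r)}$ be the set of all $a$ for which there is $\theta\in\mathcal{S}^{(0)}_{d-1}$ with $0\le a_j\le r^{\theta_j}$ for all $j$. Let $N(\epsilon,S,\|\cdot\|_\infty)$ be the minimal number of balls of radius $\epsilon$ in the sup-norm on $[0,1]^d$, closed and centered at elements of $S$, that are needed to cover a set $S$ of functions on $[0,1]^d$. Then for every $r\ge1$ and every $0<\epsilon<1/2$ these covering numbers are finite and $$\log N\Big(\epsilon,\bigcup_{a\in\mathcal{Q}^{(r)}}\mathbb{H}_1^a,\|\cdot\|_\infty\Big)=\log N\Big(\epsilon,\bigcup_{\theta\in\mathcal{S}^{(0)}_{d-1}}\ \bigcup_{0\le a\le r^\theta}\mathbb{H}_1^a,\|\cdot\|_\infty\Big)\le K\,r\,\Big(\log\frac1\epsilon\Big)^{d+1},$$ where $0\le a\le r^\theta$ means $0\le a_j\le r^{\theta_j}$ for all $j$. -/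

import Mathlib

open MeasureTheory ProbabilityTheory
open scoped NNReal UniformConvergence

noncomputable section

namespace MultiBandwidth

/-- `W` is a centered homogeneous (stationary) Gaussian random field on `ℝ^d` under `P`, with
spectral measure `ν`: its covariance is `E (W_s W_t) = c (s - t)` where
`c t = ∫ exp (-i (λ, t)) ν(dλ)`. -/
structure IsHomogeneousGaussianField {d : ℕ} {Ω : Type*} [MeasurableSpace Ω]
    (W : EuclideanSpace ℝ (Fin d) → Ω → ℝ) (P : Measure Ω)
    (ν : Measure (EuclideanSpace ℝ (Fin d))) : Prop where
  gaussian : IsGaussianProcess W P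
  centered : ∀ t, ∫ ω, W t ω ∂P = 0
  covariance : ∀ s t, ((∫ ω, W s ω * W t ω ∂P : ℝ) : ℂ) =
    ∫ l, Complex.exp (-(Complex.I * ((inner ℝ l (s - t) : ℝ) : ℂ))) ∂ν

/-- The unit cube `[0, 1]^d`. -/
def unitCube (d : ℕ) : Set (EuclideanSpace ℝ (Fin d)) :=
  {t | ∀ j, 0 ≤ t j ∧ t j ≤ 1}

/-- The rescaled process `W^a = {W_{a · t} : t ∈ [0, 1]^d}`, where `a · t` is the coordinatewise
product. -/
def rescaled {d : ℕ} {Ω : Type*} (W : EuclideanSpace ℝ (Fin d) → Ω → ℝ) (a : Fin d → ℝ) :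
    unitCube d → Ω → ℝ :=
  fun t => W (WithLp.toLp 2 (fun j => a j * t.1 j))

/-- The closure in `L²(P)` of the space of finite linear combinations `∑ aᵢ X_{sᵢ}`. -/
def linearHull {T Ω : Type*} [MeasurableSpace Ω] (X : T → Ω → ℝ) (P : Measure Ω) :
    Submodule ℝ (Lp ℝ 2 P) :=
  (Submodule.span ℝ {H : Lp ℝ 2 P | ∃ s, H =ᵐ[P] X s}).topologicalClosure

/-- `h` is the function `t ↦ E (X_t H)`. -/
def Represents {T Ω : Type*} [MeasurableSpace Ω] (X : T → Ω → ℝ) (P : Measure Ω)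
    (H : Lp ℝ 2 P) (h : T →ᵤ ℝ) : Prop :=
  ∀ t, UniformFun.toFun h t = ∫ ω, X t ω * H ω ∂P

/-- The closed unit ball of the reproducing kernel Hilbert space of `X`. The RKHS is the completion
of the functions `t ↦ E (X_t H)`, with `H` a finite linear combination of the `X_s`, for the inner
product `⟨E (X H₁), E (X H₂)⟩ = E (H₁ H₂)`. As a space of functions it consists of all
`t ↦ E (X_t H)` with `H` in the closed linear hull of `X` in `L²(P)`, and such a function has RKHS
norm `‖H‖`; the representing `H` is unique by `Represents.unique`.
The functions live in `T →ᵤ ℝ`, which is the type of functions `T → ℝ` with the extended distance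
`sup_t |f t - g t|`. -/
def rkhsUnitBall {T Ω : Type*} [MeasurableSpace Ω] (X : T → Ω → ℝ) (P : Measure Ω) :
    Set (T →ᵤ ℝ) :=
  {h | ∃ H ∈ linearHull X P, ‖H‖ ≤ 1 ∧ Represents X P H h}

/-- The RKHS norm is well defined: a function has at most one representer in the closed linear
hull. -/
theorem Represents.unique {T Ω : Type*} [MeasurableSpace Ω] {X : T → Ω → ℝ} {P : Measure Ω}
    {H₁ H₂ : Lp ℝ 2 P} {h : T →ᵤ ℝ}
    (h₁ : H₁ ∈ linearHull X P) (h₂ : H₂ ∈ linearHull X P)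
    (hr₁ : Represents X P H₁ h) (hr₂ : Represents X P H₂ h) : H₁ = H₂ := by
  have key : ∀ G ∈ linearHull X P, inner ℝ G (H₁ - H₂) = (0 : ℝ) := by
    intro G hG
    have hclosed : IsClosed {G : Lp ℝ 2 P | inner ℝ G (H₁ - H₂) = (0 : ℝ)} :=
      isClosed_eq (by fun_prop) continuous_const
    refine closure_minimal ?_ hclosed hG
    intro G hG
    induction hG using Submodule.span_induction with
    | mem G hG =>
      obtain ⟨s, hs⟩ := hG
      have e : ∀ H : Lp ℝ 2 P, inner ℝ G H = ∫ ω, X s ω * H ω ∂P := by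
        intro H
        rw [L2.inner_def]
        refine integral_congr_ae ?_
        filter_upwards [hs] with ω hω
        simp [hω, mul_comm]
      rw [Set.mem_ofPred_eq, inner_sub_right, e, e, ← hr₁ s, ← hr₂ s, sub_self]
    | zero => simp
    | add x y _ _ hx hy =>
      simp only [Set.mem_ofPred_eq] at hx hy ⊢
      rw [inner_add_left, hx, hy, add_zero]
    | smul c x _ hx =>
      simp only [Set.mem_ofPred_eq] at hx ⊢
      rw [inner_smul_left, hx, mul_zero]
  exact sub_eq_zero.mp (inner_self_eq_zero.mp (key _ (sub_mem h₁ h₂)))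

/-- The interior `{θ : θ_j > 0, ∑ θ_j = 1}` of the `(d-1)`-dimensional simplex. -/
def openSimplex (d : ℕ) : Set (Fin d → ℝ) :=
  {θ | (∀ j, 0 < θ j) ∧ ∑ j, θ j = 1}

/-- The rectangle `{a : 0 ≤ a_j ≤ u_j}`. -/
def box {d : ℕ} (u : Fin d → ℝ) : Set (Fin d → ℝ) :=
  {a | ∀ j, 0 ≤ a j ∧ a j ≤ u j}

/-- The set `Q^(r)` of all `a` with nonnegative coordinates such that `a_j ≤ r ^ θ_j` for all `j`,
for some `θ` in the open simplex. -/
def bandwidthRegion (d : ℕ) (r : ℝ) : Set (Fin d → ℝ) :=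
  {a | ∃ θ ∈ openSimplex d, ∀ j, 0 ≤ a j ∧ a j ≤ r ^ θ j}

end MultiBandwidth

end

/-! An element of `ℍ₁^a` is `h(t) = ⟨W_{a·t}, H⟩` in L²(P) with `‖H‖ ≤ 1`. By the spectral isometry,
a linear combination of the `W_s` has the norm of the same combination of characters in L²(ν).
Approximating characters by interpolation therefore approximates all these `h` at once
(`norm_sub_interpolation_le`).

Given θ, divide axis `j` into `⌈A r^θ_j⌉` cells. As `∑ θ_j = 1`, there are at most `(A+1)^d r` cells
(`ceil_mem_gridSizes`), and on each cell the rescaled frequencies are so small that tensor Lagrange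
interpolation at `n^d` nodes has error `O(e^{-n})`, the exponential moment of ν absorbing large λ
(`norm_character_sub_interpolation_le`).

The interpolation weights depend on `t` alone, not on `a` or `H`. So `h` is known within ε from the
grid and the rounded values at the nodes, and no net over `a` is needed
(`coveringNumber_le_of_cells`). With `n` and the log of the number of rounding levels both
`O(log(1/ε))`, the logarithm of the number of codes is `O(r (log(1/ε))^{d+1})`; the choice of grid
adds only `O(r)` (`exists_entropy_parameters`). -/

namespace MultiBandwidth

/-! ### Lagrange interpolation of exponentials in one variable -/

/-- The `k`-th Lagrange basis polynomial for the nodes `0, …, n - 1`, as a function. -/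
noncomputable def nodeWeight (n k : ℕ) (x : ℝ) : ℝ :=
  (Lagrange.basis (Finset.range n) (fun i : ℕ => (i : ℝ)) k).eval x

theorem sum_nodeWeight_mul_pow {n p : ℕ} (hp : p < n) (x : ℝ) :
    ∑ k ∈ Finset.range n, nodeWeight n k x * (k : ℝ) ^ p = x ^ p := by
  have hinj : Set.InjOn (fun i : ℕ => (i : ℝ)) (Finset.range n) :=
    Nat.cast_injective.injOn
  have h := Lagrange.eq_interpolate (f := (Polynomial.X ^ p : Polynomial ℝ)) hinj
    (by simpa using hp)
  have h2 := congrArg (Polynomial.eval x) h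
  rw [Lagrange.interpolate_apply, Polynomial.eval_finsetSum] at h2
  simp only [Polynomial.eval_pow, Polynomial.eval_X, Polynomial.eval_mul,
    Polynomial.eval_C] at h2
  rw [h2]
  exact Finset.sum_congr rfl fun k _ => mul_comm _ _

theorem prod_range_erase_abs_sub (k m : ℕ) :
    ∏ j ∈ (Finset.range (k + (m + 1))).erase k, |(k : ℝ) - j| = k.factorial * m.factorial := by
  -- Putting the factor 1 at `k` gives a product over a full range, which splits at `k`: the
  -- distances below give `k!`, those above give `m!`.
  have h1 : ∏ j ∈ (Finset.range (k + (m + 1))).erase k, |(k : ℝ) - j|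
      = ∏ j ∈ Finset.range (k + (m + 1)), if j = k then 1 else |(k : ℝ) - j| := by
    rw [← Finset.mul_prod_erase (Finset.range (k + (m + 1))) _
      (Finset.mem_range.2 (by omega : k < k + (m + 1)))]
    rw [if_pos rfl, one_mul]
    exact Finset.prod_congr rfl fun j hj => by rw [if_neg (Finset.ne_of_mem_erase hj)]
  rw [h1, Finset.prod_range_add, Finset.prod_range_succ']
  congr 1
  · rw [← Finset.prod_range_reflect, ← Finset.prod_range_add_one_eq_factorial, Nat.cast_prod]
    refine Finset.prod_congr rfl fun j hj => ?_
    have hj' := Finset.mem_range.1 hj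
    rw [if_neg (by omega)]
    have : ((k - 1 - j : ℕ) : ℝ) = k - 1 - j := by
      rw [Nat.sub_sub, Nat.cast_sub (by omega)]; push_cast; ring
    rw [this, abs_of_nonneg] <;> push_cast
    · ring
    · have : (0 : ℝ) ≤ j := by positivity
      linarith
  · rw [← Finset.prod_range_add_one_eq_factorial, Nat.cast_prod]
    simp only [add_zero, if_true, mul_one]
    refine Finset.prod_congr rfl fun j _ => ?_
    rw [if_neg (by omega), abs_of_nonpos] <;> push_cast <;> [ring; skip]
    have : (0 : ℝ) ≤ j := by positivity
    linarith

/-- Each factor of the numerator is at most `n`, and the denominator is `k! m!` with `k + m = n -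
1`. Hence the bound `(n^k / k!) (n^m / m!) ≤ e^n e^n`. -/
theorem abs_nodeWeight_le {n k : ℕ} (hk : k < n) {x : ℝ} (hx0 : 0 ≤ x) (hxn : x ≤ n) :
    |nodeWeight n k x| ≤ Real.exp (2 * n) := by
  obtain ⟨m, rfl⟩ : ∃ m, n = k + (m + 1) := ⟨n - k - 1, by omega⟩
  have h1 : |nodeWeight (k + (m + 1)) k x|
      = (∏ j ∈ (Finset.range (k + (m + 1))).erase k, |x - j|) / (k.factorial * m.factorial) := by
    rw [← prod_range_erase_abs_sub, ← Finset.prod_div_distrib, nodeWeight, Lagrange.basis,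
      Polynomial.eval_prod, Finset.abs_prod]
    refine Finset.prod_congr rfl fun j _ => ?_
    simp [Lagrange.basisDivisor, abs_mul, abs_inv, div_eq_inv_mul]
  set n := k + (m + 1) with hn
  have h2 : ∏ j ∈ (Finset.range n).erase k, |x - j| ≤ (n : ℝ) ^ (k + m) := by
    have hc : ((Finset.range n).erase k).card = k + m := by
      rw [Finset.card_erase_of_mem (Finset.mem_range.2 hk), Finset.card_range]; omega
    rw [← hc, ← Finset.prod_const]
    refine Finset.prod_le_prod (fun _ _ => abs_nonneg _) fun j hj => ?_
    have hj' : (j : ℝ) ≤ n := by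
      exact_mod_cast (Finset.mem_range.1 (Finset.mem_of_mem_erase hj)).le
    have : (0 : ℝ) ≤ j := by positivity
    rw [abs_le]; constructor <;> linarith
  rw [h1]
  calc _ ≤ (n : ℝ) ^ (k + m) / (k.factorial * m.factorial) := by gcongr
    _ = ((n : ℝ) ^ k / k.factorial) * ((n : ℝ) ^ m / m.factorial) := by
        rw [pow_add, mul_div_mul_comm]
    _ ≤ Real.exp n * Real.exp n := by
        have h := fun p => Real.pow_div_factorial_le_exp (n : ℝ) (Nat.cast_nonneg n) p
        exact mul_le_mul (h k) (h m) (by positivity) (by positivity)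
    _ = Real.exp (2 * n) := by rw [← Real.exp_add]; ring_nf

theorem sum_abs_nodeWeight_le {n : ℕ} {x : ℝ} (hx0 : 0 ≤ x) (hxn : x ≤ n) :
    ∑ k ∈ Finset.range n, |nodeWeight n k x| ≤ Real.exp (3 * n) := by
  calc _ ≤ ∑ k ∈ Finset.range n, Real.exp (2 * n) :=
        Finset.sum_le_sum fun k hk => abs_nodeWeight_le (Finset.mem_range.1 hk) hx0 hxn
    _ = n * Real.exp (2 * n) := by simp
    _ ≤ Real.exp n * Real.exp (2 * n) := by
        gcongr
        linarith [Real.add_one_le_exp (n : ℝ)]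
    _ = _ := by rw [← Real.exp_add]; ring_nf

/-- Terms of degree at least `n` gain a factor at least `K^n` when `y` is replaced by `K y`. This
buys geometric decay at any rate, without smallness of `y`, for a larger exponent. -/
theorem exp_sub_sum_le {K y : ℝ} (hK : 1 ≤ K) (hy : 0 ≤ y) (n : ℕ) :
    Real.exp y - ∑ m ∈ Finset.range n, y ^ m / m.factorial ≤ (K ^ n)⁻¹ * Real.exp (K * y) := by
  have hs : ∀ z : ℝ, HasSum (fun m : ℕ => z ^ m / m.factorial) (Real.exp z) := fun z => by
    rw [Real.exp_eq_exp_ℝ]; exact NormedSpace.expSeries_div_hasSum_exp z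
  have h1 := (hasSum_nat_add_iff' n).2 (hs y)
  have h2 := ((hasSum_nat_add_iff' n).2 (hs (K * y))).mul_left ((K ^ n)⁻¹)
  have h3 := hasSum_le (fun m => ?_) h1 h2
  · refine h3.trans ?_
    gcongr
    have : 0 ≤ ∑ m ∈ Finset.range n, (K * y) ^ m / m.factorial := by positivity
    linarith
  · have hK' : 1 ≤ K ^ m := one_le_pow₀ hK
    rw [mul_pow, pow_add K, mul_div_assoc, mul_comm (K ^ m), mul_assoc,
      inv_mul_cancel_left₀ (by positivity)]
    exact le_mul_of_one_le_left (by positivity) hK'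

theorem norm_cexp_sub_sum_le {K y : ℝ} (hK : 1 ≤ K) {x : ℂ} (hx : ‖x‖ ≤ y) (n : ℕ) :
    ‖Complex.exp x - ∑ m ∈ Finset.range n, x ^ m / m.factorial‖
      ≤ (K ^ n)⁻¹ * Real.exp (K * y) :=
  (Complex.norm_exp_sub_sum_le_exp_norm_sub_sum x n).trans <|
    (exp_sub_sum_le hK (norm_nonneg x) n).trans (by gcongr)

/-- Interpolation at `n` nodes reproduces the Taylor polynomial `T` of degree below `n`. The error
is thus the Taylor remainder at `u` minus the interpolant of the remainder, at most `(1 + e^{3n})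
D`. -/
theorem norm_cexp_sub_interpolation_le {K : ℝ} (hK : 1 ≤ K) {n : ℕ} (hn : 0 < n)
    {u : ℝ} (hu0 : 0 ≤ u) (hu1 : u ≤ 1) (b : ℝ) :
    ‖Complex.exp (-(Complex.I * (b * u : ℝ)))
      - ∑ k ∈ Finset.range n, (nodeWeight n k (n * u) : ℂ)
          * Complex.exp (-(Complex.I * (b * (k / n) : ℝ)))‖
      ≤ 2 * Real.exp (3 * n) * ((K ^ n)⁻¹ * Real.exp (K * |b|)) := by
  set D := (K ^ n)⁻¹ * Real.exp (K * |b|) with hD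
  have hn' : (n : ℝ) ≠ 0 := by positivity
  have hD0 : 0 ≤ D := by positivity
  let T : ℝ → ℂ := fun v => ∑ m ∈ Finset.range n, (-(Complex.I * (b * v : ℝ))) ^ m / m.factorial
  have hT : ∀ v, 0 ≤ v → v ≤ 1 → ‖Complex.exp (-(Complex.I * (b * v : ℝ))) - T v‖ ≤ D := by
    intro v h0 h1
    refine norm_cexp_sub_sum_le hK ?_ n
    rw [norm_neg, norm_mul, Complex.norm_I, one_mul, Complex.norm_real, Real.norm_eq_abs, abs_mul,
      abs_of_nonneg h0]
    exact mul_le_of_le_one_right (abs_nonneg _) h1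
  have hrep : T u = ∑ k ∈ Finset.range n, (nodeWeight n k (n * u) : ℂ) * T (k / n) := by
    simp only [T, Finset.mul_sum]
    rw [Finset.sum_comm]
    refine Finset.sum_congr rfl fun m hm => ?_
    have h := sum_nodeWeight_mul_pow (Finset.mem_range.1 hm) (n * u)
    have hu : u ^ m = ∑ k ∈ Finset.range n, nodeWeight n k (n * u) * ((k : ℝ) / n) ^ m := by
      simp only [div_pow, ← mul_div_assoc]
      rw [← Finset.sum_div, h, mul_pow, mul_div_cancel_left₀ _ (by positivity)]
    have hu' := congrArg (fun z : ℝ => (z : ℂ)) hu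
    push_cast at hu'
    have e : ∀ v : ℝ, (-(Complex.I * (b * v : ℝ))) ^ m / (m.factorial : ℂ)
        = (-(Complex.I * b)) ^ m / m.factorial * (v : ℂ) ^ m := by
      intro v; push_cast; rw [← mul_assoc, ← neg_mul, mul_pow]; ring
    simp only [e]
    rw [hu', Finset.mul_sum]
    refine Finset.sum_congr rfl fun k _ => ?_
    push_cast; ring
  have hΛ := sum_abs_nodeWeight_le (n := n) (x := n * u) (by positivity)
    (mul_le_of_le_one_right (by positivity) hu1)
  have hΛ1 : 1 ≤ Real.exp (3 * n) := Real.one_le_exp (by positivity)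
  have hdec : Complex.exp (-(Complex.I * (b * u : ℝ)))
      - ∑ k ∈ Finset.range n, (nodeWeight n k (n * u) : ℂ)
          * Complex.exp (-(Complex.I * (b * (k / n) : ℝ)))
      = (Complex.exp (-(Complex.I * (b * u : ℝ))) - T u)
        - ∑ k ∈ Finset.range n, (nodeWeight n k (n * u) : ℂ)
          * (Complex.exp (-(Complex.I * (b * (k / n) : ℝ))) - T (k / n)) := by
    simp only [mul_sub, Finset.sum_sub_distrib, ← hrep]; ring
  rw [hdec]
  refine (norm_sub_le _ _).trans ?_
  have h2 : ‖∑ k ∈ Finset.range n, (nodeWeight n k (n * u) : ℂ)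
          * (Complex.exp (-(Complex.I * (b * (k / n) : ℝ))) - T (k / n))‖
      ≤ Real.exp (3 * n) * D := by
    refine (norm_sum_le _ _).trans ?_
    refine le_trans ?_ (mul_le_mul_of_nonneg_right hΛ hD0)
    rw [Finset.sum_mul]
    refine Finset.sum_le_sum fun k hk => ?_
    rw [norm_mul, Complex.norm_real, Real.norm_eq_abs]
    gcongr
    refine hT _ (by positivity) ?_
    rw [div_le_one (by positivity)]
    exact_mod_cast (Finset.mem_range.1 hk).le
  have h1 := hT u hu0 hu1
  nlinarith

/-! ### Tensor interpolation of characters on a cell -/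

theorem norm_prod_sub_prod_le {ι : Type*} (s : Finset ι) (x y : ι → ℂ) {L e : ℝ} (hL : 1 ≤ L)
    (hx : ∀ i ∈ s, ‖x i‖ ≤ L) (hy : ∀ i ∈ s, ‖y i‖ ≤ L) (hxy : ∀ i ∈ s, ‖x i - y i‖ ≤ e) :
    ‖∏ i ∈ s, x i - ∏ i ∈ s, y i‖ ≤ s.card * (L ^ s.card * e) := by
  classical
  induction s using Finset.induction_on with
  | empty => simp
  | insert a s ha ih =>
    have ih' := ih (fun i hi => hx i (Finset.mem_insert_of_mem hi))
      (fun i hi => hy i (Finset.mem_insert_of_mem hi))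
      (fun i hi => hxy i (Finset.mem_insert_of_mem hi))
    have hxa := hx a (Finset.mem_insert_self a s)
    have hea := hxy a (Finset.mem_insert_self a s)
    have he : 0 ≤ e := (norm_nonneg _).trans hea
    rw [Finset.prod_insert ha, Finset.prod_insert ha, Finset.card_insert_of_notMem ha]
    have hp : ‖∏ i ∈ s, y i‖ ≤ L ^ s.card := by
      rw [norm_prod, ← Finset.prod_const]
      exact Finset.prod_le_prod (fun _ _ => norm_nonneg _)
        fun i hi => hy i (Finset.mem_insert_of_mem hi)
    calc ‖x a * ∏ i ∈ s, x i - y a * ∏ i ∈ s, y i‖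
        = ‖x a * (∏ i ∈ s, x i - ∏ i ∈ s, y i) + (x a - y a) * ∏ i ∈ s, y i‖ := by ring_nf
      _ ≤ ‖x a‖ * ‖∏ i ∈ s, x i - ∏ i ∈ s, y i‖ + ‖x a - y a‖ * ‖∏ i ∈ s, y i‖ := by
          refine (norm_add_le _ _).trans ?_
          rw [norm_mul, norm_mul]
      _ ≤ L * (s.card * (L ^ s.card * e)) + e * L ^ s.card := by gcongr
      _ ≤ L * (s.card * (L ^ s.card * e)) + L * (e * L ^ s.card) := by
          have := le_mul_of_one_le_left (a := L) (b := e * L ^ s.card) (by positivity) hL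
          linarith
      _ = _ := by push_cast; ring

/-- The character `l ↦ exp (-i (l, s))`. -/
noncomputable def character {d : ℕ} (s l : EuclideanSpace ℝ (Fin d)) : ℂ :=
  Complex.exp (-(Complex.I * ((inner ℝ l s : ℝ) : ℂ)))

theorem norm_character {d : ℕ} (s l : EuclideanSpace ℝ (Fin d)) : ‖character s l‖ = 1 := by
  rw [character, Complex.norm_exp]; simp

theorem continuous_character {d : ℕ} (s : EuclideanSpace ℝ (Fin d)) : Continuous (character s) := by
  unfold character; fun_prop

theorem character_mul_conj {d : ℕ} (s t l : EuclideanSpace ℝ (Fin d)) :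
    character s l * (starRingEnd ℂ) (character t l) = character (s - t) l := by
  simp only [character, ← Complex.exp_conj, ← Complex.exp_add]
  congr 1
  simp only [map_neg, map_mul, Complex.conj_I, Complex.conj_ofReal, inner_sub_right]
  push_cast; ring

/-- The coordinatewise product. -/
def scale {d : ℕ} (a t : Fin d → ℝ) : EuclideanSpace ℝ (Fin d) :=
  WithLp.toLp 2 (fun j => a j * t j)

theorem character_scale {d : ℕ} (a t : Fin d → ℝ) (l : EuclideanSpace ℝ (Fin d)) :
    character (scale a t) l
      = ∏ j, Complex.exp (-(Complex.I * ((l j * a j * t j : ℝ) : ℂ))) := by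
  rw [character, ← Complex.exp_sum, Finset.sum_neg_distrib, ← Finset.mul_sum]
  congr 3
  rw [← Complex.ofReal_sum]
  congr 1
  simp only [scale, PiLp.inner_apply]
  refine Finset.sum_congr rfl fun j _ => ?_
  simp; ring

/-- The interpolation nodes: the `n^d` grid points in the cell with index `c` when the `j`-th axis
of the unit cube is divided into `m j` cells. -/
noncomputable def node {d : ℕ} (n : ℕ) (m c : Fin d → ℕ) (κ : Fin d → Fin n) : Fin d → ℝ :=
  fun j => (c j + (κ j : ℕ) / n) / m j

/-- Tensor product of Lagrange weights. -/
noncomputable def tensorWeight {d n : ℕ} (u : Fin d → ℝ) (κ : Fin d → Fin n) : ℝ :=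
  ∏ j, nodeWeight n (κ j) (n * u j)

theorem sum_abs_tensorWeight_le {d n : ℕ} {u : Fin d → ℝ} (hu : ∀ j, 0 ≤ u j ∧ u j ≤ 1) :
    ∑ κ : Fin d → Fin n, |tensorWeight u κ| ≤ Real.exp (3 * n) ^ d := by
  have h : ∀ j, ∑ k : Fin n, |nodeWeight n k (n * u j)| ≤ Real.exp (3 * n) := fun j => by
    rw [Fin.sum_univ_eq_sum_range fun k => |nodeWeight n k (n * u j)|]
    exact sum_abs_nodeWeight_le (mul_nonneg (by positivity) (hu j).1)
      (mul_le_of_le_one_right (by positivity) (hu j).2)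
  calc _ = ∏ j : Fin d, ∑ k : Fin n, |nodeWeight n k (n * u j)| := by
        rw [Finset.prod_univ_sum, Fintype.piFinset_univ]
        simp [tensorWeight, Finset.abs_prod]
    _ ≤ ∏ _j : Fin d, Real.exp (3 * n) :=
        Finset.prod_le_prod (fun _ _ => Finset.sum_nonneg fun _ _ => abs_nonneg _) fun j _ => h j
    _ = _ := by simp

/-- On a cell the character is a product of one-variable exponentials in `u j` with frequencies `b j
= l j * a j / m j`, up to phases from the cell's corner. The condition on `a` turns `e^{K |b j|}`
into `e^{δ‖l‖/2}`, which is square integrable. -/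
theorem norm_character_sub_interpolation_le {d n : ℕ} (hn : 0 < n) {K δ : ℝ} (hK : 1 ≤ K)
    {m c : Fin d → ℕ} {u t a : Fin d → ℝ} (hu : ∀ j, 0 ≤ u j ∧ u j ≤ 1)
    (ht : ∀ j, t j = (c j + u j) / m j) (ha : ∀ j, 0 ≤ a j ∧ K * (a j / m j) ≤ δ / 2)
    (l : EuclideanSpace ℝ (Fin d)) :
    ‖character (scale a t) l
      - ∑ κ : Fin d → Fin n, (tensorWeight u κ : ℂ) * character (scale a (node n m c κ)) l‖
      ≤ d * (Real.exp (3 * n) ^ d *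
          (2 * Real.exp (3 * n) * ((K ^ n)⁻¹ * Real.exp (δ / 2 * ‖l‖)))) := by
  let b : Fin d → ℝ := fun j => l j * (a j / m j)
  have hb : ∀ j, K * |b j| ≤ δ / 2 * ‖l‖ := fun j => by
    have hl : |l j| ≤ ‖l‖ := by simpa using PiLp.norm_apply_le l j
    have h0 : 0 ≤ a j / m j := div_nonneg (ha j).1 (by positivity)
    rw [abs_mul, abs_of_nonneg h0]
    calc K * (|l j| * (a j / m j)) = (K * (a j / m j)) * |l j| := by ring
      _ ≤ δ / 2 * ‖l‖ := mul_le_mul (ha j).2 hl (abs_nonneg _)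
          ((by positivity : 0 ≤ K * (a j / m j)).trans (ha j).2)
  let φ : Fin d → ℂ := fun j => Complex.exp (-(Complex.I * (b j * c j : ℝ)))
  have hφ : ∀ j, ‖φ j‖ = 1 := fun j => by simp only [φ]; rw [Complex.norm_exp]; simp
  have hsplit : ∀ j (v : ℝ), Complex.exp (-(Complex.I * ((l j * a j * ((c j + v) / m j) : ℝ) : ℂ)))
      = φ j * Complex.exp (-(Complex.I * (b j * v : ℝ))) := fun j v => by
    simp only [φ, b]
    rw [← Complex.exp_add]
    congr 1
    push_cast; ring
  let x : Fin d → ℂ := fun j => φ j * Complex.exp (-(Complex.I * (b j * u j : ℝ)))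
  let y : Fin d → ℂ := fun j => φ j * ∑ k ∈ Finset.range n, (nodeWeight n k (n * u j) : ℂ)
          * Complex.exp (-(Complex.I * (b j * (k / n) : ℝ)))
  have hx : character (scale a t) l = ∏ j, x j := by
    rw [character_scale]
    refine Finset.prod_congr rfl fun j _ => ?_
    rw [ht j, hsplit]
  have hy : ∑ κ : Fin d → Fin n, (tensorWeight u κ : ℂ) * character (scale a (node n m c κ)) l
      = ∏ j, y j := by
    have : ∀ j, y j = ∑ k : Fin n, (nodeWeight n k (n * u j) : ℂ) *
        (φ j * Complex.exp (-(Complex.I * (b j * ((k : ℕ) / n) : ℝ)))) := fun j => by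
      rw [Fin.sum_univ_eq_sum_range fun k => (nodeWeight n k (n * u j) : ℂ) *
        (φ j * Complex.exp (-(Complex.I * (b j * ((k : ℕ) / n) : ℝ))))]
      simp only [y, Finset.mul_sum]
      exact Finset.sum_congr rfl fun _ _ => by ring
    simp only [this]
    rw [Finset.prod_univ_sum, Fintype.piFinset_univ]
    refine Finset.sum_congr rfl fun κ _ => ?_
    rw [character_scale, tensorWeight, Complex.ofReal_prod, ← Finset.prod_mul_distrib]
    refine Finset.prod_congr rfl fun j _ => ?_
    rw [node, hsplit]
  have hΛ1 : 1 ≤ Real.exp (3 * n) := Real.one_le_exp (by positivity)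
  rw [hx, hy]
  have h := norm_prod_sub_prod_le Finset.univ x y hΛ1
    (e := 2 * Real.exp (3 * n) * ((K ^ n)⁻¹ * Real.exp (δ / 2 * ‖l‖))) ?_ ?_ ?_
  · simpa using h
  · intro j _
    simp only [x]
    rw [norm_mul, hφ, one_mul, Complex.norm_exp]
    simp
  · intro j _
    simp only [y]
    rw [norm_mul, hφ, one_mul]
    refine (norm_sum_le _ _).trans (le_trans (Finset.sum_le_sum fun k _ => ?_)
      (sum_abs_nodeWeight_le (mul_nonneg (by positivity) (hu j).1)
      (mul_le_of_le_one_right (by positivity) (hu j).2) : _ ≤ Real.exp (3 * (n : ℝ))))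
    rw [norm_mul, Complex.norm_real, Complex.norm_exp]
    simp
  · intro j _
    simp only [x, y]
    rw [← mul_sub, norm_mul, hφ, one_mul]
    refine (norm_cexp_sub_interpolation_le hK hn (hu j).1 (hu j).2 (b j)).trans ?_
    have := hb j
    gcongr

/-! ### From characters to the field: the spectral isometry -/

section Hilbert

variable {d : ℕ} {ν : Measure (EuclideanSpace ℝ (Fin d))} [IsFiniteMeasure ν]
  {F : Type*} [NormedAddCommGroup F] [InnerProductSpace ℝ F] {X : EuclideanSpace ℝ (Fin d) → F}

theorem integrable_character (s : EuclideanSpace ℝ (Fin d)) : Integrable (character s) ν :=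
  Integrable.of_bound (continuous_character s).aestronglyMeasurable 1
    (Filter.Eventually.of_forall fun l => (norm_character s l).le)

theorem norm_sum_smul_sq
    (hX : ∀ s t, ((inner ℝ (X s) (X t) : ℝ) : ℂ) = ∫ l, character (s - t) l ∂ν)
    {ι : Type*} (S : Finset ι) (z : ι → ℝ) (p : ι → EuclideanSpace ℝ (Fin d)) :
    ‖∑ i ∈ S, z i • X (p i)‖ ^ 2 = ∫ l, ‖∑ i ∈ S, (z i : ℂ) * character (p i) l‖ ^ 2 ∂ν := by
  apply Complex.ofReal_injective
  rw [← real_inner_self_eq_norm_sq, sum_inner, Complex.ofReal_sum, ← integral_complex_ofReal]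
  have h : ∀ l, ((‖∑ i ∈ S, (z i : ℂ) * character (p i) l‖ ^ 2 : ℝ) : ℂ)
      = ∑ i ∈ S, ∑ j ∈ S, (z i * z j : ℂ) * character (p i - p j) l := fun l => by
    rw [Complex.ofReal_pow, ← Complex.mul_conj', map_sum, Finset.sum_mul_sum]
    refine Finset.sum_congr rfl fun i _ => Finset.sum_congr rfl fun j _ => ?_
    rw [map_mul, Complex.conj_ofReal, ← character_mul_conj]
    ring
  simp only [h]
  rw [integral_finsetSum _ fun i _ => integrable_finsetSum _ fun j _ =>
    (integrable_character _).const_mul _]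
  refine Finset.sum_congr rfl fun i _ => ?_
  rw [integral_finsetSum _ fun j _ => (integrable_character _).const_mul _, inner_sum,
    Complex.ofReal_sum]
  refine Finset.sum_congr rfl fun j _ => ?_
  rw [integral_const_mul, ← hX, real_inner_smul_left, real_inner_smul_right]
  push_cast; ring

theorem norm_sub_sum_smul_le
    (hX : ∀ s t, ((inner ℝ (X s) (X t) : ℝ) : ℂ) = ∫ l, character (s - t) l ∂ν)
    {δ : ℝ} (hδ : Integrable (fun l => Real.exp (δ * ‖l‖)) ν)
    {ι : Type*} [Fintype ι] (z : ι → ℝ) (p : ι → EuclideanSpace ℝ (Fin d))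
    (s : EuclideanSpace ℝ (Fin d)) {G : ℝ} (hG : 0 ≤ G)
    (h : ∀ l, ‖character s l - ∑ i, (z i : ℂ) * character (p i) l‖
      ≤ G * Real.exp (δ / 2 * ‖l‖)) :
    ‖X s - ∑ i, z i • X (p i)‖ ≤ G * √(∫ l, Real.exp (δ * ‖l‖) ∂ν) := by
  -- The point `s` joins the family as index `none` with coefficient -1, so that the isometry
  -- applies to the whole difference.
  have hsq := norm_sum_smul_sq hX (Finset.univ : Finset (Option ι))
    (fun o => o.elim (-1) z) (fun o => o.elim s p)
  simp only [Fintype.sum_option, Option.elim] at hsq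
  have h1 : ‖X s - ∑ i, z i • X (p i)‖ ^ 2 ≤ G ^ 2 * ∫ l, Real.exp (δ * ‖l‖) ∂ν := by
    rw [norm_sub_rev, ← neg_add_eq_sub, ← neg_one_smul ℝ (X s), hsq, ← integral_const_mul]
    refine integral_mono_of_nonneg (Filter.Eventually.of_forall fun l => by positivity)
      (hδ.const_mul _) (Filter.Eventually.of_forall fun l => ?_)
    dsimp only
    have e : Real.exp (δ * ‖l‖) = Real.exp (δ / 2 * ‖l‖) ^ 2 := by
      rw [← Real.exp_nat_mul]; congr 1; push_cast; ring
    rw [e, ← mul_pow]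
    refine pow_le_pow_left₀ (norm_nonneg _) ?_ 2
    have := h l
    rw [norm_sub_rev, ← neg_add_eq_sub] at this
    simpa using this
  refine le_of_sq_le_sq ?_ (by positivity)
  rwa [mul_pow, Real.sq_sqrt (integral_nonneg fun l => (Real.exp_pos _).le)]

theorem norm_sub_interpolation_le
    (hX : ∀ s t, ((inner ℝ (X s) (X t) : ℝ) : ℂ) = ∫ l, character (s - t) l ∂ν)
    {δ : ℝ} (hδ : Integrable (fun l => Real.exp (δ * ‖l‖)) ν) {n : ℕ} (hn : 0 < n)
    {m c : Fin d → ℕ} {u t a : Fin d → ℝ} (hu : ∀ j, 0 ≤ u j ∧ u j ≤ 1)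
    (ht : ∀ j, t j = (c j + u j) / m j)
    (ha : ∀ j, 0 ≤ a j ∧ Real.exp (3 * d + 4) * (a j / m j) ≤ δ / 2) :
    ‖X (scale a t) - ∑ κ : Fin d → Fin n, tensorWeight u κ • X (scale a (node n m c κ))‖
      ≤ 2 * d * Real.exp (-n) * √(∫ l, Real.exp (δ * ‖l‖) ∂ν) := by
  refine norm_sub_sum_smul_le hX hδ _ _ _ (by positivity) fun l => ?_
  refine (norm_character_sub_interpolation_le hn (Real.one_le_exp (by positivity)) hu ht ha
    l).trans (le_of_eq ?_)
  -- The constant `3d + 4` is chosen so that `K^{-n}` beats the `d + 1` factors `e^{3n}` and leaves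
  -- `e^{-n}`.
  have : Real.exp (-n) = Real.exp (3 * n) ^ d * Real.exp (3 * n)
      * (Real.exp (3 * d + 4) ^ n)⁻¹ := by
    rw [← Real.exp_nat_mul, ← Real.exp_nat_mul, ← Real.exp_neg, ← Real.exp_add, ← Real.exp_add]
    congr 1; ring
  rw [this]; ring

theorem norm_le_sqrt_integral_exp
    (hX : ∀ s t, ((inner ℝ (X s) (X t) : ℝ) : ℂ) = ∫ l, character (s - t) l ∂ν)
    {δ : ℝ} (hδ0 : 0 ≤ δ) (hδ : Integrable (fun l => Real.exp (δ * ‖l‖)) ν)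
    (s : EuclideanSpace ℝ (Fin d)) : ‖X s‖ ≤ √(∫ l, Real.exp (δ * ‖l‖) ∂ν) := by
  -- Approximation by the empty sum, with error 1 because characters are unimodular.
  have h := norm_sub_sum_smul_le hX hδ (ι := Empty) (fun _ => 0) (fun _ => 0) s (G := 1)
    zero_le_one fun l => by
      simpa [norm_character] using (by positivity : 0 ≤ δ / 2 * ‖l‖)
  simpa using h

end Hilbert

/-! ### Covering by finite codes -/

/-- One point of `A` is chosen for each code in use, so the centres lie in `A`. A relation replaces
a coding function because a code may depend on a choice of representation of `x`. -/
theorem coveringNumber_le_card_of_code {X ι : Type*} [PseudoEMetricSpace X] [Fintype ι] {A : Set X}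
    {ε : ℝ≥0} (R : X → ι → Prop) (hR : ∀ x ∈ A, ∃ i, R x i)
    (hε : ∀ x ∈ A, ∀ y ∈ A, ∀ i, R x i → R y i → edist x y ≤ ε) :
    Metric.coveringNumber ε A ≤ Fintype.card ι := by
  classical
  rcases A.eq_empty_or_nonempty with rfl | ⟨x₀, hx₀⟩
  · simp
  have hg : ∀ i, ∃ y ∈ A, (∃ x ∈ A, R x i) → R y i := fun i => by
    by_cases h : ∃ x ∈ A, R x i
    · obtain ⟨x, hx, hxi⟩ := h
      exact ⟨x, hx, fun _ => hxi⟩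
    · exact ⟨x₀, hx₀, fun h' => absurd h' h⟩
  choose g hgA hg using hg
  have hcover : Metric.IsCover ε A (Set.range g) := by
    intro x hx
    obtain ⟨i, hi⟩ := hR x hx
    exact ⟨g i, Set.mem_range_self i, hε x hx _ (hgA i) i hi (hg i ⟨x, hx, hi⟩)⟩
  refine (hcover.coveringNumber_le_encard (Set.range_subset_iff.2 hgA)).trans ?_
  rw [← Set.image_univ]
  refine (Set.encard_image_le _ _).trans ?_
  simp

theorem exists_cell {t : ℝ} (h0 : 0 ≤ t) (h1 : t ≤ 1) {m : ℕ} (hm : 0 < m) :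
    ∃ (c : Fin m) (u : ℝ), (0 ≤ u ∧ u ≤ 1) ∧ t = ((c : ℕ) + u) / m := by
  have hm' : (0 : ℝ) < m := by exact_mod_cast hm
  -- The endpoint `t = 1` belongs to the last cell, with `u = 1`; elsewhere the floor selects the
  -- cell.
  rcases h1.eq_or_lt with rfl | h1
  · refine ⟨⟨m - 1, by omega⟩, 1, by norm_num, ?_⟩
    rw [eq_div_iff hm'.ne', Nat.cast_sub (by omega : 1 ≤ m)]
    push_cast; ring
  · have hlt : ⌊t * m⌋₊ < m := by
      rw [Nat.floor_lt (by positivity)]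
      nlinarith
    refine ⟨⟨⌊t * m⌋₊, hlt⟩, t * m - ⌊t * m⌋₊, ⟨?_, ?_⟩, ?_⟩
    · linarith [Nat.floor_le (by positivity : 0 ≤ t * m)]
    · linarith [Nat.lt_floor_add_one (t * m)]
    · field_simp; ring

theorem abs_sub_le_of_floor_div_eq {x y η : ℝ} (hη : 0 < η) (hx : 0 ≤ x) (hy : 0 ≤ y)
    (h : ⌊x / η⌋₊ = ⌊y / η⌋₊) : |x - y| ≤ η := by
  have hx1 := Nat.floor_le (div_nonneg hx hη.le)
  have hx2 := Nat.lt_floor_add_one (x / η)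
  have hy1 := Nat.floor_le (div_nonneg hy hη.le)
  have hy2 := Nat.lt_floor_add_one (y / η)
  rw [h] at hx1 hx2
  have e : x - y = (x / η - y / η) * η := by field_simp
  rw [e, abs_mul, abs_of_pos hη]
  refine mul_le_of_le_one_left hη.le ?_
  rw [abs_le]; constructor <;> linarith

section Hilbert

variable {d : ℕ} {ν : Measure (EuclideanSpace ℝ (Fin d))} [IsFiniteMeasure ν]
  {F : Type*} [NormedAddCommGroup F] [InnerProductSpace ℝ F] {X : EuclideanSpace ℝ (Fin d) → F}

theorem abs_inner_sub_interpolation_le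
    (hX : ∀ s t, ((inner ℝ (X s) (X t) : ℝ) : ℂ) = ∫ l, character (s - t) l ∂ν)
    {δ : ℝ} (hδ : Integrable (fun l => Real.exp (δ * ‖l‖)) ν) {n : ℕ} (hn : 0 < n)
    {m c : Fin d → ℕ} {u t a : Fin d → ℝ} (hu : ∀ j, 0 ≤ u j ∧ u j ≤ 1)
    (ht : ∀ j, t j = (c j + u j) / m j)
    (ha : ∀ j, 0 ≤ a j ∧ Real.exp (3 * d + 4) * (a j / m j) ≤ δ / 2) {H : F} (hH : ‖H‖ ≤ 1) :
    |inner ℝ (X (scale a t)) H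
      - ∑ κ : Fin d → Fin n, tensorWeight u κ * inner ℝ (X (scale a (node n m c κ))) H|
      ≤ 2 * d * Real.exp (-n) * √(∫ l, Real.exp (δ * ‖l‖) ∂ν) := by
  have h := norm_sub_interpolation_le hX hδ hn hu ht ha
  have e : inner ℝ (X (scale a t)) H
      - ∑ κ : Fin d → Fin n, tensorWeight u κ * inner ℝ (X (scale a (node n m c κ))) H
      = inner ℝ (X (scale a t)
        - ∑ κ : Fin d → Fin n, tensorWeight u κ • X (scale a (node n m c κ))) H := by
    rw [inner_sub_left, sum_inner]
    simp only [real_inner_smul_left]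
  rw [e]
  refine (abs_real_inner_le_norm _ _).trans (le_trans ?_ h)
  exact mul_le_of_le_one_right (norm_nonneg _) hH

/-- Functions with the same code share the grid and hence the weights, even for different `a`. They
differ by at most two interpolation errors `ε/4` plus the rounding error `η`, amplified by the
Lebesgue constant to `ε/2`. -/
theorem coveringNumber_le_of_cells
    (hX : ∀ s t, ((inner ℝ (X s) (X t) : ℝ) : ℂ) = ∫ l, character (s - t) l ∂ν)
    {δ : ℝ} (hδ0 : 0 ≤ δ) (hδ : Integrable (fun l => Real.exp (δ * ‖l‖)) ν)
    {n : ℕ} (hn : 0 < n) {B η : ℝ} (hB : B = √(∫ l, Real.exp (δ * ‖l‖) ∂ν)) (hη : 0 < η)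
    {ε : ℝ≥0} (hnε : 2 * d * Real.exp (-n) * B ≤ ε / 4)
    (hηε : η * Real.exp (3 * n) ^ d ≤ ε / 2) {Q N : ℕ} (hQ : 2 * B / η < Q)
    (S : Set (unitCube d →ᵤ ℝ)) (I : Finset (Fin d → ℕ))
    (hI : ∀ m ∈ I, (∀ j, 0 < m j) ∧ ∏ j, m j ≤ N)
    (hS : ∀ h ∈ S, ∃ m ∈ I, ∃ (a : Fin d → ℝ) (H : F), ‖H‖ ≤ 1 ∧
      (∀ j, 0 ≤ a j ∧ Real.exp (3 * d + 4) * (a j / m j) ≤ δ / 2) ∧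
      ∀ t, UniformFun.toFun h t = inner ℝ (X (scale a t.1)) H) :
    Metric.coveringNumber ε S ≤ (I.card * Q ^ (N * n ^ d) : ℕ) := by
  -- A code is a grid `m` with one of `Q` levels for each pair of cell and node. The values lie in
  -- `[-B, B]`; the shift by `B` below makes them nonnegative for the natural floor.
  let Code := Σ m : I, (((j : Fin d) → Fin (m.1 j)) × (Fin d → Fin n) → Fin Q)
  let R : (unitCube d →ᵤ ℝ) → Code → Prop := fun h q => ∃ (a : Fin d → ℝ) (H : F), ‖H‖ ≤ 1 ∧
      (∀ j, 0 ≤ a j ∧ Real.exp (3 * d + 4) * (a j / q.1.1 j) ≤ δ / 2) ∧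
      (∀ t, UniformFun.toFun h t = inner ℝ (X (scale a t.1)) H) ∧
      ∀ c κ, ((q.2 (c, κ) : Fin Q) : ℕ)
        = ⌊(inner ℝ (X (scale a (node n q.1.1 (fun j => (c j : ℕ)) κ))) H + B) / η⌋₊
  have hbound : ∀ s (H : F), ‖H‖ ≤ 1 → |inner ℝ (X s) H| ≤ B := fun s H hH => by
    rw [hB]
    refine (abs_real_inner_le_norm _ _).trans (le_trans ?_ (norm_le_sqrt_integral_exp hX hδ0 hδ s))
    exact mul_le_of_le_one_right (norm_nonneg _) hH
  have hcard : Fintype.card Code ≤ I.card * Q ^ (N * n ^ d) := by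
    have hQ0 : 0 < Q := by
      have : 0 ≤ 2 * B / η := by rw [hB]; positivity
      exact_mod_cast this.trans_lt hQ
    rw [Fintype.card_sigma]
    refine (Finset.sum_le_card_nsmul _ _ (Q ^ (N * n ^ d)) fun m _ => ?_).trans (by simp)
    rw [Fintype.card_fun, Fintype.card_prod, Fintype.card_pi, Fintype.card_fun]
    simp only [Fintype.card_fin]
    exact Nat.pow_le_pow_right hQ0 (Nat.mul_le_mul_right _ (hI m.1 m.2).2)
  refine (coveringNumber_le_card_of_code R ?_ ?_).trans (by exact_mod_cast hcard)
  · intro h hh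
    obtain ⟨m, hm, a, H, hH, ha, hrep⟩ := hS h hh
    refine ⟨⟨⟨m, hm⟩, fun p =>
      ⟨⌊(inner ℝ (X (scale a (node n m (fun j => (p.1 j : ℕ)) p.2))) H + B) / η⌋₊, ?_⟩⟩,
      a, H, hH, ha, hrep, fun c κ => rfl⟩
    have hb := abs_le.1 (hbound (scale a (node n m (fun j => (p.1 j : ℕ)) p.2)) H hH)
    rw [Nat.floor_lt (div_nonneg (by linarith [hb.1]) hη.le)]
    refine lt_of_le_of_lt ?_ hQ
    gcongr
    linarith [hb.2]
  · rintro h - h' - ⟨⟨m, hm⟩, q⟩ ⟨a, H, hH, ha, hrep, hq⟩ ⟨a', H', hH', ha', hrep', hq'⟩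
    rw [UniformFun.edist_le]
    intro t
    choose c u hu ht using fun j => exists_cell (t.2 j).1 (t.2 j).2 ((hI m hm).1 j)
    have e1 := abs_inner_sub_interpolation_le hX hδ hn hu ht ha hH
    have e2 := abs_inner_sub_interpolation_le hX hδ hn hu ht ha' hH'
    rw [← hB] at e1 e2
    have e3 : |∑ κ : Fin d → Fin n,
          tensorWeight u κ * inner ℝ (X (scale a (node n m (fun j => (c j : ℕ)) κ))) H
        - ∑ κ : Fin d → Fin n,
          tensorWeight u κ * inner ℝ (X (scale a' (node n m (fun j => (c j : ℕ)) κ))) H'|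
        ≤ ε / 2 := by
      rw [← Finset.sum_sub_distrib]
      refine (Finset.abs_sum_le_sum_abs _ _).trans (le_trans ?_ hηε)
      refine le_trans ?_ (mul_le_mul_of_nonneg_left (sum_abs_tensorWeight_le hu) hη.le)
      rw [Finset.mul_sum]
      refine Finset.sum_le_sum fun κ _ => ?_
      rw [← mul_sub, abs_mul, mul_comm]
      gcongr
      have hb := abs_le.1 (hbound (scale a (node n m (fun j => (c j : ℕ)) κ)) H hH)
      have hb' := abs_le.1 (hbound (scale a' (node n m (fun j => (c j : ℕ)) κ)) H' hH')
      have := abs_sub_le_of_floor_div_eq hη (by linarith [hb.1]) (by linarith [hb'.1])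
        ((hq c κ).symm.trans (hq' c κ))
      rwa [add_sub_add_right_eq_sub] at this
    rw [hrep, hrep', edist_dist, Real.dist_eq]
    refine ENNReal.ofReal_le_of_le_toReal ?_
    rw [ENNReal.coe_toReal, abs_le]
    rw [abs_le] at e1 e2 e3
    constructor <;> linarith [e1.1, e1.2, e2.1, e2.2, e3.1, e3.2]

end Hilbert

/-! ### Choice of parameters and count of grids -/

theorem exists_entropy_parameters (d : ℕ) {A B : ℝ} (hA : 0 < A) (hB : 0 ≤ B) :
    ∃ K : ℝ, 0 < K ∧ ∀ r : ℝ, 1 ≤ r → ∀ ε : ℝ, 0 < ε → ε < 1 / 2 →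
      ∃ (n Q : ℕ) (η : ℝ), 0 < n ∧ 0 < η ∧ 2 * d * Real.exp (-n) * B ≤ ε / 4 ∧
        η * Real.exp (3 * n) ^ d ≤ ε / 2 ∧ 2 * B / η < Q ∧
        d * Real.log (⌈A * r⌉₊ + 1) + (A + 1) ^ d * r * n ^ d * Real.log Q
          ≤ K * r * Real.log (1 / ε) ^ (d + 1) := by
  set c₁ := Real.log (8 * d * B + 1) with hc₁
  -- Since `ε < 1/2` gives `1 ≤ 2L`, additive constants are absorbed into multiples of `L`: `L + c₁
  -- + 1 ≤ c₂ L`, and likewise `log Q ≤ c₃ L`.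
  set c₂ := 3 + 2 * c₁ with hc₂
  set c₃ := 2 * Real.log (4 * B + 1) + 3 * c₂ * d + 1 with hc₃
  have hc₁0 : 0 ≤ c₁ := Real.log_nonneg (by have : 0 ≤ 8 * d * B := by positivity
                                            linarith)
  have hlog0 : 0 ≤ Real.log (4 * B + 1) := Real.log_nonneg (by linarith)
  have hc₃0 : 0 ≤ c₃ := by positivity
  refine ⟨d * (A + 1) * 2 ^ (d + 1) + (A + 1) ^ d * c₂ ^ d * c₃ + 1, by positivity, ?_⟩
  intro r hr ε hε0 hε
  set L := Real.log (1 / ε) with hL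
  have hL2 : 1 / 2 ≤ L := by
    have h1 : Real.log 2 ≤ L :=
      Real.log_le_log (by norm_num) (by rw [le_div_iff₀ hε0]; linarith)
    linarith [Real.log_two_gt_d9]
  have hexpL : Real.exp (-L) = ε := by
    rw [hL, one_div, Real.log_inv, neg_neg, Real.exp_log hε0]
  set n := ⌈L + c₁⌉₊ with hn
  have hn1 : L + c₁ ≤ n := Nat.le_ceil _
  have hn2 : (n : ℝ) ≤ c₂ * L := by
    have := (Nat.ceil_lt_add_one (by linarith : 0 ≤ L + c₁)).le
    rw [hc₂]
    nlinarith
  set E := Real.exp (3 * n) ^ d with hE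
  have hE1 : 1 ≤ E := one_le_pow₀ (Real.one_le_exp (by positivity))
  set η := ε / (2 * E) with hη
  have hη0 : 0 < η := by positivity
  set Q := ⌊2 * B / η⌋₊ + 1 with hQ
  refine ⟨n, Q, η, ?_, hη0, ?_, ?_, ?_, ?_⟩
  · exact Nat.ceil_pos.2 (by linarith)
  · have h1 : Real.exp (-n) ≤ ε / (8 * d * B + 1) := by
      calc Real.exp (-n) ≤ Real.exp (-L + -c₁) := Real.exp_le_exp.2 (by linarith)
        _ = _ := by
          rw [Real.exp_add, hexpL, Real.exp_neg, hc₁, Real.exp_log (by positivity)]; rfl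
    calc 2 * d * Real.exp (-n) * B ≤ 2 * d * (ε / (8 * d * B + 1)) * B := by gcongr
      _ = ε / 4 * ((8 * d * B) / (8 * d * B + 1)) := by ring
      _ ≤ ε / 4 := by
        refine mul_le_of_le_one_right (by positivity) ?_
        rw [div_le_one (by positivity)]
        linarith
  · rw [← hE, hη]; apply le_of_eq; field_simp
  · rw [hQ]; push_cast; exact Nat.lt_floor_add_one _
  · have hQle : (Q : ℝ) ≤ (4 * B + 1) * E * (1 / ε) := by
      have h1 : (Q : ℝ) ≤ 2 * B / η + 1 := by
        rw [hQ]; push_cast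
        linarith [Nat.floor_le (by positivity : 0 ≤ 2 * B / η)]
      have h2 : 2 * B / η = 4 * B * E * (1 / ε) := by rw [hη]; field_simp; ring
      have h3 : 1 ≤ E * (1 / ε) :=
        one_le_mul_of_one_le_of_one_le hE1 (by rw [le_div_iff₀ hε0]; linarith)
      rw [h2] at h1
      linarith
    have hlogQ : Real.log Q ≤ c₃ * L := by
      have hQpos : (0 : ℝ) < Q := by rw [hQ]; positivity
      have hElog : Real.log E = d * (3 * n) := by rw [hE, Real.log_pow, Real.log_exp]
      calc Real.log Q ≤ Real.log ((4 * B + 1) * E * (1 / ε)) := Real.log_le_log hQpos hQle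
        _ = Real.log (4 * B + 1) + d * (3 * n) + L := by
          rw [Real.log_mul (by positivity) (by positivity),
            Real.log_mul (by positivity) (by positivity), hElog]
        _ ≤ Real.log (4 * B + 1) * (2 * L) + d * (3 * (c₂ * L)) + L := by
          gcongr
          exact le_mul_of_one_le_right hlog0 (by linarith)
        _ = _ := by rw [hc₃]; ring
    have hlogQ0 : 0 ≤ Real.log Q := Real.log_natCast_nonneg _
    have h1 : Real.log (⌈A * r⌉₊ + 1) ≤ (A + 1) * r := by
      have h := Nat.ceil_lt_add_one (by positivity : 0 ≤ A * r)
      have h' := Real.log_le_sub_one_of_pos (by positivity : (0 : ℝ) < ⌈A * r⌉₊ + 1)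
      linarith
    have h2 : 1 ≤ 2 ^ (d + 1) * L ^ (d + 1) := by
      rw [← mul_pow]; exact one_le_pow₀ (by linarith)
    have hLp : 0 ≤ L := by linarith
    calc d * Real.log (⌈A * r⌉₊ + 1) + (A + 1) ^ d * r * n ^ d * Real.log Q
        ≤ d * ((A + 1) * r) * (2 ^ (d + 1) * L ^ (d + 1))
          + (A + 1) ^ d * r * (c₂ * L) ^ d * (c₃ * L) := by
          refine add_le_add ?_ (by gcongr)
          exact (mul_le_mul_of_nonneg_left h1 (by positivity)).trans
            (le_mul_of_one_le_right (by positivity) h2)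
      _ = (d * (A + 1) * 2 ^ (d + 1) + (A + 1) ^ d * c₂ ^ d * c₃) * r * L ^ (d + 1) := by
          rw [mul_pow]; ring
      _ ≤ _ := by
          have : 0 ≤ r * L ^ (d + 1) := by positivity
          nlinarith

/-- The numbers of cells per axis that occur when the axes are divided into `⌈A * r ^ θ j⌉` cells,
`θ` in the open simplex. -/
noncomputable def gridSizes (d : ℕ) (A r : ℝ) : Finset (Fin d → ℕ) :=
  (Fintype.piFinset fun _ => Finset.range (⌈A * r⌉₊ + 1)).filter
    fun m => (∀ j, 0 < m j) ∧ ∏ j, m j ≤ ⌊(A + 1) ^ d * r⌋₊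

theorem card_gridSizes_le (d : ℕ) (A r : ℝ) : (gridSizes d A r).card ≤ (⌈A * r⌉₊ + 1) ^ d :=
  (Finset.card_filter_le _ _).trans (by simp)

/-- For `x ≥ 1` one has `⌈A x⌉ ≤ (A + 1) x`, and the product of the `r^θ_j` is `r`. Infinitely many
θ thus use only finitely many grids, each with `O(r)` cells. -/
theorem ceil_mem_gridSizes {d : ℕ} {A r : ℝ} (hA : 0 < A) (hr : 1 ≤ r) {θ : Fin d → ℝ}
    (hθ : θ ∈ openSimplex d) : (fun j => ⌈A * r ^ θ j⌉₊) ∈ gridSizes d A r := by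
  have hr0 : 0 < r := by linarith
  rw [gridSizes, Finset.mem_filter, Fintype.mem_piFinset]
  refine ⟨fun j => ?_, fun j => Nat.ceil_pos.2 (by positivity), ?_⟩
  · rw [Finset.mem_range, Nat.lt_succ_iff]
    refine Nat.ceil_le_ceil ?_
    have hθ1 : θ j ≤ 1 := by
      rw [← hθ.2]
      exact Finset.single_le_sum (fun i _ => (hθ.1 i).le) (Finset.mem_univ j)
    gcongr
    calc r ^ θ j ≤ r ^ (1 : ℝ) := Real.rpow_le_rpow_of_exponent_le hr hθ1
      _ = r := Real.rpow_one r
  · refine Nat.le_floor ?_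
    rw [Nat.cast_prod]
    calc ∏ j, (⌈A * r ^ θ j⌉₊ : ℝ) ≤ ∏ j, (A + 1) * r ^ θ j := by
          refine Finset.prod_le_prod (fun _ _ => by positivity) fun j _ => ?_
          have h1 : 1 ≤ r ^ θ j := Real.one_le_rpow hr (hθ.1 j).le
          have h2 := Nat.ceil_lt_add_one (by positivity : 0 ≤ A * r ^ θ j)
          linarith
      _ = (A + 1) ^ d * r := by
          rw [Finset.prod_mul_distrib, ← Real.rpow_sum_of_pos hr0, hθ.2, Real.rpow_one]
          simp

/-! ### The field in L²(P) and the conclusion -/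

/-- The random variable `W_s` as an element of `L²(P)`. -/
noncomputable def IsHomogeneousGaussianField.toL2 {d : ℕ} {Ω : Type*} [MeasurableSpace Ω]
    {P : Measure Ω} {W : EuclideanSpace ℝ (Fin d) → Ω → ℝ}
    {ν : Measure (EuclideanSpace ℝ (Fin d))} (hW : IsHomogeneousGaussianField W P ν)
    (s : EuclideanSpace ℝ (Fin d)) : Lp ℝ 2 P :=
  (hW.gaussian.hasGaussianLaw_eval s).memLp_two.toLp (W s)

theorem IsHomogeneousGaussianField.inner_toL2 {d : ℕ} {Ω : Type*} [MeasurableSpace Ω]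
    {P : Measure Ω} {W : EuclideanSpace ℝ (Fin d) → Ω → ℝ}
    {ν : Measure (EuclideanSpace ℝ (Fin d))} (hW : IsHomogeneousGaussianField W P ν)
    (s : EuclideanSpace ℝ (Fin d)) (H : Lp ℝ 2 P) :
    inner ℝ (hW.toL2 s) H = ∫ ω, W s ω * H ω ∂P := by
  rw [L2.inner_def]
  refine integral_congr_ae ?_
  filter_upwards [MemLp.coeFn_toLp (hW.gaussian.hasGaussianLaw_eval s).memLp_two] with ω hω
  simp [toL2, hω, mul_comm]

theorem IsHomogeneousGaussianField.inner_toL2_toL2 {d : ℕ} {Ω : Type*} [MeasurableSpace Ω]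
    {P : Measure Ω} {W : EuclideanSpace ℝ (Fin d) → Ω → ℝ}
    {ν : Measure (EuclideanSpace ℝ (Fin d))} (hW : IsHomogeneousGaussianField W P ν)
    (s t : EuclideanSpace ℝ (Fin d)) :
    ((inner ℝ (hW.toL2 s) (hW.toL2 t) : ℝ) : ℂ) = ∫ l, character (s - t) l ∂ν := by
  rw [hW.inner_toL2]
  refine Eq.trans ?_ (hW.covariance s t)
  congr 1
  refine integral_congr_ae ?_
  filter_upwards [MemLp.coeFn_toLp (hW.gaussian.hasGaussianLaw_eval t).memLp_two] with ω hω
  simp [toL2, hω]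

end MultiBandwidth

open MultiBandwidth in
theorem lemma4p7 {d : ℕ} (hd : 0 < d)
    (ν : Measure (EuclideanSpace ℝ (Fin d))) [IsFiniteMeasure ν]
    (hν : ∃ δ : ℝ, 0 < δ ∧ Integrable (fun l => Real.exp (δ * ‖l‖)) ν) :
    ∃ K : ℝ, 0 < K ∧
      ∀ (Ω : Type*) [MeasurableSpace Ω] (P : Measure Ω) [IsProbabilityMeasure P]
        (W : EuclideanSpace ℝ (Fin d) → Ω → ℝ),
        MultiBandwidth.IsHomogeneousGaussianField W P ν →
        ∀ (r : ℝ), 1 ≤ r → ∀ (ε : ℝ≥0), 0 < ε → ε < 1 / 2 →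
          Metric.coveringNumber ε
              (⋃ a ∈ MultiBandwidth.bandwidthRegion d r,
                MultiBandwidth.rkhsUnitBall (MultiBandwidth.rescaled W a) P) =
            Metric.coveringNumber ε
              (⋃ θ ∈ MultiBandwidth.openSimplex d,
                ⋃ a ∈ MultiBandwidth.box (fun j => r ^ θ j),
                  MultiBandwidth.rkhsUnitBall (MultiBandwidth.rescaled W a) P) ∧
          Metric.coveringNumber ε
              (⋃ a ∈ MultiBandwidth.bandwidthRegion d r,
                MultiBandwidth.rkhsUnitBall (MultiBandwidth.rescaled W a) P) ≠ ⊤ ∧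
          Real.log (Metric.coveringNumber ε
              (⋃ a ∈ MultiBandwidth.bandwidthRegion d r,
                MultiBandwidth.rkhsUnitBall (MultiBandwidth.rescaled W a) P)).toNat ≤
            K * r * Real.log (1 / (ε : ℝ)) ^ (d + 1) := by
  obtain ⟨δ, hδ0, hδ⟩ := hν
  set K₀ := Real.exp (3 * d + 4) with hK₀
  have hK₀pos : 0 < K₀ := Real.exp_pos _
  -- This `A` makes `⌈A r^θ_j⌉` cells on axis `j` enough for `K₀ a_j / m_j ≤ δ / 2` whenever `a_j ≤
  -- r^θ_j`.
  set A := 2 * K₀ / δ with hA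
  have hA0 : 0 < A := by positivity
  obtain ⟨K, hK, hpar⟩ := exists_entropy_parameters d hA0
    (Real.sqrt_nonneg (∫ l, Real.exp (δ * ‖l‖) ∂ν))
  refine ⟨K, hK, ?_⟩
  intro Ω _ P _ W hW r hr ε hε0 hε
  have hr0 : 0 < r := by linarith
  refine ⟨?_, ?_⟩
  · congr 1
    ext h
    simp only [bandwidthRegion, box, Set.mem_iUnion, Set.mem_ofPred_eq, exists_prop]
    constructor
    · rintro ⟨a, ⟨θ, hθ, ha⟩, hh⟩
      exact ⟨θ, hθ, a, ha, hh⟩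
    · rintro ⟨θ, hθ, a, ha, hh⟩
      exact ⟨a, ⟨θ, hθ, ha⟩, hh⟩
  · obtain ⟨n, Q, η, hn, hη, hnε, hηε, hQ, hbound⟩ := hpar r hr ε hε0 (by exact_mod_cast hε)
    set S := ⋃ a ∈ bandwidthRegion d r, rkhsUnitBall (rescaled W a) P with hS
    have hcov : Metric.coveringNumber ε S
        ≤ ((gridSizes d A r).card * Q ^ (⌊(A + 1) ^ d * r⌋₊ * n ^ d) : ℕ) := by
      refine coveringNumber_le_of_cells hW.inner_toL2_toL2 hδ0.le hδ hn rfl hη hnε hηε hQ S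
        (gridSizes d A r) (fun m hm => (Finset.mem_filter.1 hm).2) ?_
      intro h hh
      simp only [hS, Set.mem_iUnion] at hh
      obtain ⟨a, ⟨θ, hθ, ha⟩, H, -, hH, hrep⟩ := hh
      refine ⟨_, ceil_mem_gridSizes hA0 hr hθ, a, H, hH, fun j => ⟨(ha j).1, ?_⟩, fun t => ?_⟩
      · have hpos : 0 < A * r ^ θ j := by positivity
        have hceil : A * r ^ θ j ≤ ⌈A * r ^ θ j⌉₊ := Nat.le_ceil _
        calc K₀ * (a j / ⌈A * r ^ θ j⌉₊) ≤ K₀ * (r ^ θ j / (A * r ^ θ j)) := by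
              have h1 := (ha j).2
              gcongr
          _ = δ / 2 := by
              have : r ^ θ j ≠ 0 := (by positivity : 0 < r ^ θ j).ne'
              rw [hA]; field_simp
      · rw [hrep t, hW.inner_toL2]
        rfl
    have htop : Metric.coveringNumber ε S ≠ ⊤ := ne_top_of_le_ne_top (ENat.natCast_ne_top _) hcov
    refine ⟨htop, ?_⟩
    have hnat : (Metric.coveringNumber ε S).toNat
        ≤ (gridSizes d A r).card * Q ^ (⌊(A + 1) ^ d * r⌋₊ * n ^ d) :=
      ENat.toNat_le_of_le_natCast hcov
    have hQ0 : 0 < Q := by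
      have h0 : (0 : ℝ) < Q := lt_of_le_of_lt (by positivity) hQ
      exact_mod_cast h0
    have hle : (Metric.coveringNumber ε S).toNat
        ≤ (⌈A * r⌉₊ + 1) ^ d * Q ^ (⌊(A + 1) ^ d * r⌋₊ * n ^ d) :=
      hnat.trans (Nat.mul_le_mul_right _ (card_gridSizes_le d A r))
    refine le_trans ?_ hbound
    have hlogQ : 0 ≤ Real.log Q := Real.log_natCast_nonneg _
    -- If the covering number is 0, `Real.log 0 = 0` and the bound only has to be nonnegative.
    rcases Nat.eq_zero_or_pos (Metric.coveringNumber ε S).toNat with h0 | hpos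
    · rw [h0, Nat.cast_zero, Real.log_zero]
      have : 0 ≤ Real.log (⌈A * r⌉₊ + 1) := by
        exact_mod_cast Real.log_natCast_nonneg (⌈A * r⌉₊ + 1)
      positivity
    · calc Real.log (Metric.coveringNumber ε S).toNat
          ≤ Real.log (((⌈A * r⌉₊ + 1) ^ d * Q ^ (⌊(A + 1) ^ d * r⌋₊ * n ^ d) : ℕ) : ℝ) :=
            Real.log_le_log (by exact_mod_cast hpos) (by exact_mod_cast hle)
        _ = d * Real.log (⌈A * r⌉₊ + 1) + ⌊(A + 1) ^ d * r⌋₊ * n ^ d * Real.log Q := by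
            push_cast
            rw [Real.log_mul (by positivity) (by positivity), Real.log_pow, Real.log_pow]
            push_cast; ring
        _ ≤ _ := by
            gcongr
            exact Nat.floor_le (by positivity)
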